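/- Let $d\ge 1$. All simplicial complexes are finite. Let $K$ be a geometric simplicial complex in $\mathbb R^{d+1}$ whose vertices lie on the unit sphere $\mathbb S^d$ and such that the radial projection $x\mapsto x/\|x\|$ is a homeomorphism from the underlying space $|K|$ onto $\mathbb S^d$. Let $\delta$ be the maximal Euclidean edge length of $K$, and put $$\ell(\delta)=1-\sqrt{1-\tfrac12\tfrac{d}{d+1}\delta^2}.$$ Let $L$ be a geometric simplicial complex in some $\mathbb R^m$ and let $F\colon\mathbb S^d\to|L|$ be a continuous map. *The algorithm.* Fix a subdivision method (barycentric or edgewise). Put $K_0=K$; the complex $K_{i+1}$ is the subdivision of $K_i$ in which every vertex $v$ (a barycenter of a simplex of $K_i$ for the barycentric subdivision, a vertex or midpoint of an edge of $K_i$ for the edgewise one) is then moved to $v/\|v\|\in\mathbb S^d$. Let $f_i\colon|K_i|\to|L|$ be $f_i(x)=F(x/\|x\|)$. The map $f_i$ satisfies the *star condition* if for every vertex $v$ of $K_i$ there is a vertex $w$ of $L$ such that $f_i$ maps the closed star of $v$ (the union of the closed simplices that are faces of simplices containing $v$) into the open star of $w$ (the union of the relative interiors of the simplices of $L$ containing $w$).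 The algorithm tests $i=0,1,2,\dots$ successively, stops at the first $i$ for which $f_i$ satisfies the star condition, and returns a *weak simplicial approximation* to $f_i$: a map $g$ from the vertices of $K_i$ to the vertices of $L$ such that, for every vertex $v$ of $K_i$, $f_i$ maps $v$ and all its neighbours into the open star of $g(v)$. *Edgewise subdivision.* It is taken with respect to a total order on the vertices of $K$, which may be arbitrary. The vertices of the edgewise subdivision of a complex whose vertices are partially ordered, with a total order on each simplex, are the midpoints $m_{xy}$ of the pairs $x\le y$ of vertices spanning a simplex (with $m_{xx}=x$). The points $m_{x_0y_0},\dots,m_{x_py_p}$ (suitably numbered) span a simplex if and only if $x_0\le\dots\le x_p\le y_0\le\dots\le y_p$ and all the $x_j,y_j$ lie in a common simplex. The new vertices inherit the componentwise order ($m_{xy}\le m_{x'y'}$ iff $x\le x'$ and $y\le y'$), which is used for the next subdivision. Then: 1. With barycentric subdivisions the algorithm terminates, provided that $\delta^{-1}\ell(\delta)<\dfrac1{2(d+1)}$. 2. With edgewise subdivisions the algorithm terminates, provided that $\delta^{-1}\ell(\delta)<\dfrac14\left(\dfrac{\log d}{2\log 2}+1\right)^{-1}$. -/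

import Mathlib

open Set Metric

namespace SphereApprox

noncomputable section

/-! ### Vertex-ordered simplicial complexes with a realization of their vertices -/

/-- An abstract simplicial complex on a type `V` of labels, together with a position in `E` for each
label and a partial order on the labels that is total on every simplex. The vertices are the labels
`v` with `{v}` a simplex; labels that are not vertices play no role. The order is used by the
edgewise subdivision only. -/
structure RealizedComplex (E : Type) where
  V : Type
  order : PartialOrder V
  cx : PreAbstractSimplicialComplex V
  isChain : ∀ s ∈ cx.faces, IsChain (fun u v => u ≤ v) (s : Set V)
  pos : V → E

namespace RealizedComplex

variable {E : Type}

instance (C : RealizedComplex E) : PartialOrder C.V := C.order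

def vertices (C : RealizedComplex E) : Set C.V := {v | {v} ∈ C.cx.faces}

/-- The open star of `v`: all simplices containing `v`. -/
def star (C : RealizedComplex E) (v : C.V) : Set (Finset C.V) := {s ∈ C.cx.faces | v ∈ s}

/-- The closed star of `v`: the smallest subcomplex containing the open star. -/
def closedStar (C : RealizedComplex E) (v : C.V) : Set (Finset C.V) :=
  {t ∈ C.cx.faces | ∃ s ∈ C.star v, t ⊆ s}

/-- The underlying space of a subcomplex: the union of the convex hulls of its simplices. -/
def space [AddCommGroup E] [Module ℝ E] (C : RealizedComplex E) (T : Set (Finset C.V)) : Set E :=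
  ⋃ s ∈ T, convexHull ℝ (C.pos '' (s : Set C.V))

/-- A geometric simplicial complex with a total order on its vertices. -/
def ofGeometric [AddCommGroup E] [Module ℝ E] (K : Geometry.SimplicialComplex ℝ E)
    (ord : LinearOrder K.vertices) : RealizedComplex E where
  V := K.vertices
  order := ord.toPartialOrder
  cx :=
    { faces := {s | s.map (Function.Embedding.subtype _) ∈ K.faces}
      isRelLowerSet_faces := by
        intro s hs
        refine ⟨by simpa using K.nonempty_of_mem_faces hs, fun t hts ht => ?_⟩
        exact K.down_closed hs (Finset.map_subset_map.2 hts) (by simpa using ht) }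
  isChain := fun _ _ u _ v _ _ => ord.le_total u v
  pos := fun v => (v : E)

/-- The barycentric subdivision: its vertices are the simplices `s` of `C`, placed at their
barycenters, and its simplices are the nonempty chains of simplices of `C` under inclusion. -/
def barycentric [AddCommGroup E] [Module ℝ E] (C : RealizedComplex E) : RealizedComplex E where
  V := Finset C.V
  order := inferInstance
  cx :=
    { faces := {S | S.Nonempty ∧ (∀ s ∈ S, s ∈ C.cx.faces) ∧
        IsChain (fun s t : Finset C.V => s ⊆ t) (S : Set (Finset C.V))}
      isRelLowerSet_faces := by
        intro S hS
        refine ⟨hS.1, fun T hTS hT => ⟨hT, fun s hs => hS.2.1 s (hTS hs), ?_⟩⟩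
        exact hS.2.2.mono (Finset.coe_subset.2 hTS) }
  isChain := fun _ hS => hS.2.2
  pos := fun s => (s.card : ℝ)⁻¹ • ∑ v ∈ s, C.pos v

open Classical in
/-- The edgewise subdivision (the two-fold edgewise subdivision of Edelsbrunner and Grayson).
A vertex is a pair `(x, y)`, `x ≤ y`, spanning a simplex of `C` (a vertex if `x = y`, an edge
otherwise), placed at the midpoint of `x` and `y`. Pairs `(x₀, y₀), …, (xₚ, yₚ)` span a simplex iff,
suitably numbered, `x₀ ≤ ⋯ ≤ xₚ ≤ y₀ ≤ ⋯ ≤ yₚ`, and all the `xᵢ, yᵢ` together span a simplex of `C`.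
The new vertices inherit the componentwise order. -/
def edgewise [AddCommGroup E] [Module ℝ E] (C : RealizedComplex E) : RealizedComplex E where
  V := C.V × C.V
  order := inferInstance
  cx :=
    { faces := {S | S.Nonempty ∧ S.image Prod.fst ∪ S.image Prod.snd ∈ C.cx.faces ∧
        IsChain (fun p q : C.V × C.V => p ≤ q) (S : Set (C.V × C.V)) ∧
        ∀ p ∈ S, ∀ q ∈ S, p.1 ≤ q.2}
      isRelLowerSet_faces := by
        intro S hS
        refine ⟨hS.1, fun T hTS hT => ⟨hT, ?_, hS.2.2.1.mono (Finset.coe_subset.2 hTS),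
          fun p hp q hq => hS.2.2.2 p (hTS hp) q (hTS hq)⟩⟩
        refine (C.cx.isRelLowerSet_faces hS.2.1).2 ?_ ?_
        · exact Finset.union_subset_union (Finset.image_subset_image hTS)
            (Finset.image_subset_image hTS)
        · exact (hT.image Prod.fst).mono Finset.subset_union_left }
  isChain := fun _ hS => hS.2.2.1
  pos := fun p => midpoint ℝ (C.pos p.1) (C.pos p.2)

/-- Move every vertex `v` to `v / ‖v‖`, keeping the abstract complex. -/
def normalizeVertices [NormedAddCommGroup E] [NormedSpace ℝ E] (C : RealizedComplex E) :
    RealizedComplex E where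
  V := C.V
  order := C.order
  cx := C.cx
  isChain := C.isChain
  pos := fun v => NormedSpace.normalize (C.pos v)

end RealizedComplex

/-! ### Star condition and weak simplicial approximations -/

/-- The (relative) interior of the simplex with vertex set `s`: the points all of whose barycentric
coordinates are positive. For `s = {v}` this is `{v}`. -/
def openSimplex {E : Type} [AddCommGroup E] [Module ℝ E] (s : Finset E) : Set E :=
  {x | ∃ c : E → ℝ, (∀ v ∈ s, 0 < c v) ∧ ∑ v ∈ s, c v = 1 ∧ ∑ v ∈ s, c v • v = x}

/-- The realization of the open star of the vertex `w` of `L`: the union of the interiors of the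
simplices having `w` as a vertex. -/
def openStarSpace {E : Type} [AddCommGroup E] [Module ℝ E] (L : Geometry.SimplicialComplex ℝ E)
    (w : E) : Set E :=
  ⋃ s ∈ {s ∈ L.faces | w ∈ s}, openSimplex s

section

variable {E E' : Type} [AddCommGroup E] [Module ℝ E] [AddCommGroup E'] [Module ℝ E']

/-- The star condition for `f : |C| → |L|`. -/
def StarCondition (C : RealizedComplex E) (L : Geometry.SimplicialComplex ℝ E') (f : E → E') :
    Prop :=
  ∀ v ∈ C.vertices, ∃ w ∈ L.vertices, f '' C.space (C.closedStar v) ⊆ openStarSpace L w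

/-- `g` is a weak simplicial approximation to `f : |C| → |L|`: for every vertex `v`, the map `f`
sends `v` and all its neighbours into the open star of the vertex `g v`. -/
def IsWeakSimplicialApprox (C : RealizedComplex E) (L : Geometry.SimplicialComplex ℝ E')
    (f : E → E') (g : C.vertices → L.vertices) : Prop :=
  ∀ v : C.vertices, ∀ u : C.V, {u} ∈ C.closedStar (v : C.V) →
    f (C.pos u) ∈ openStarSpace L (g v : E')

end

/-! ### The algorithm -/

/-- `Run sub L f C C' g`: the algorithm
`while f : |C| → |L| does not satisfy the star condition: replace C by sub C, normalize the vertices;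
return a weak simplicial approximation to f`,
started at `C`, stops with final complex `C'` and output `g`. -/
inductive Run {E E' : Type} [NormedAddCommGroup E] [NormedSpace ℝ E] [AddCommGroup E']
    [Module ℝ E'] (sub : RealizedComplex E → RealizedComplex E)
    (L : Geometry.SimplicialComplex ℝ E') (f : E → E') :
    RealizedComplex E → (C' : RealizedComplex E) → (C'.vertices → L.vertices) → Prop
  | exit (C : RealizedComplex E) (g : C.vertices → L.vertices) :
      StarCondition C L f → IsWeakSimplicialApprox C L f g → Run sub L f C C g
  | loop (C C' : RealizedComplex E) (g : C'.vertices → L.vertices) :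
      ¬ StarCondition C L f → Run sub L f (sub C).normalizeVertices C' g → Run sub L f C C' g

/-- The algorithm stops after finitely many steps. (All steps but the choice of the output among
the weak simplicial approximations are deterministic.) -/
def Terminates {E E' : Type} [NormedAddCommGroup E] [NormedSpace ℝ E] [AddCommGroup E']
    [Module ℝ E'] (sub : RealizedComplex E → RealizedComplex E)
    (L : Geometry.SimplicialComplex ℝ E') (f : E → E') (C : RealizedComplex E) : Prop :=
  ∃ (C' : RealizedComplex E) (g : C'.vertices → L.vertices), Run sub L f C C' g

/-! ### Quantities in the statement -/

/-- The radial projection `x ↦ x / ‖x‖` is a homeomorphism from `|K|` onto the unit sphere. -/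
def IsRadialTriangulation {E : Type} [NormedAddCommGroup E] [NormedSpace ℝ E]
    (K : Geometry.SimplicialComplex ℝ E) : Prop :=
  ∃ h : K.space ≃ₜ sphere (0 : E) 1, ∀ x : K.space, (h x : E) = NormedSpace.normalize (x : E)

open Classical in
/-- The maximal edge length. -/
def maxEdgeLength {E : Type} [NormedAddCommGroup E] [NormedSpace ℝ E]
    (K : Geometry.SimplicialComplex ℝ E) : ℝ :=
  sSup {r | ∃ u v : E, ({u, v} : Finset E) ∈ K.faces ∧ r = dist u v}

/-- `ℓ(δ) = 1 - √(1 - (1/2) (d/(d+1)) δ²)`. -/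
def ell (d : ℕ) (δ : ℝ) : ℝ := 1 - √(1 - 1 / 2 * ((d : ℝ) / (d + 1)) * δ ^ 2)

end

end SphereApprox

/-! It suffices that the edge lengths of the complexes `K_i` tend to 0: a Lebesgue number of the
cover of the sphere by the `F`-preimages of the open stars of `L` then yields the star condition
(`terminates_of_mesh`). One step of the algorithm subdivides the flat simplices and projects
radially; the projection stretches by at most `ρ⁻¹` if the new vertices have norm at least `ρ`
before projecting (`mul_dist_normalize_le`).

Barycentric case: simplices have at most `d + 1` vertices, so subdivision contracts by `d / (d +
1)`, while barycenters have norm at least `ρ = 1 - ℓ(δ)`. Since `δ ≤ 2`, the hypothesis forces `ρ >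
d / (d + 1)`. The mesh therefore contracts by a factor below 1, and the same `ρ` serves at all later
stages.

Edgewise case: a single step need not shrink edges, since a new edge is only bounded by the mean of
two old ones. What is halved, up to the projection, is the length of monotone vertex paths: the two
coordinate paths of a new path join to a monotone path in an old simplex. If `1/u` bounds the
squared edges and `a/u` the squared paths, a step turns `(u, a)` into `(u - 1/4, a/4)`
(`SphericalPathLE.edgewise`). Initially `a = d²`, so `⌈log₂ d⌉` steps bring `a` down to 1. From then
on the path bound also controls edges and each step improves `u` to `4u - 1`, which diverges when `u
> 1/3`. The hypothesis on `δ` ensures that `u` is still above `1/3` after the preliminary steps. -/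

namespace SphereApprox

open Geometry

/-! ### Open stars and their complements -/

section OpenStars

variable {E : Type} [AddCommGroup E] [Module ℝ E]

lemma eq_zero_of_affineIndependent_coe {s : Finset E}
    (hs : AffineIndependent ℝ ((↑) : s → E)) {c : E → ℝ} (h0 : ∑ v ∈ s, c v = 0)
    (h1 : ∑ v ∈ s, c v • v = 0) {v : E} (hv : v ∈ s) : c v = 0 :=
  affineIndependent_iff.1 hs Finset.univ (fun x => c x)
    ((Finset.sum_coe_sort s c).trans h0)
    ((Finset.sum_coe_sort s fun v => c v • v).trans h1) ⟨v, hv⟩ (Finset.mem_univ _)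

lemma openSimplex_subset_convexHull (s : Finset E) :
    openSimplex s ⊆ convexHull ℝ (s : Set E) := by
  rintro x ⟨c, hc, h1, hx⟩
  exact Finset.mem_convexHull'.2 ⟨c, fun v hv => (hc v hv).le, h1, hx⟩

lemma exists_mem_openSimplex {s : Finset E} {x : E} (hx : x ∈ convexHull ℝ (s : Set E)) :
    ∃ t ⊆ s, t.Nonempty ∧ x ∈ openSimplex t := by
  classical
  obtain ⟨c, hc, h1, hx⟩ := Finset.mem_convexHull'.1 hx
  have key : ∀ v ∈ s, ¬ 0 < c v → c v = 0 := fun v hv h => le_antisymm (not_lt.1 h) (hc v hv)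
  have h1' : ∑ v ∈ s.filter (0 < c ·), c v = 1 := by
    rw [Finset.sum_filter_of_ne, h1]
    exact fun v hv hne => by_contra fun h => hne (key v hv h)
  refine ⟨s.filter (0 < c ·), Finset.filter_subset _ _, ?_, c,
    fun v hv => (Finset.mem_filter.1 hv).2, h1', ?_⟩
  · exact Finset.nonempty_of_sum_ne_zero (by rw [h1']; exact one_ne_zero)
  · rw [Finset.sum_filter_of_ne, hx]
    exact fun v hv hne => by_contra fun h => hne (by rw [key v hv h, zero_smul])

variable (L : SimplicialComplex ℝ E)

/-- Two simplices meet in the hull of their common vertices, so by uniqueness of barycentric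
coordinates a point interior to a simplex containing `w` lies in no simplex avoiding `w`. For finite
`L` this makes open stars relatively open. -/
lemma mem_openStarSpace_iff {x w : E} (hx : x ∈ L.space) :
    x ∈ openStarSpace L w ↔ ∀ t ∈ L.faces, w ∉ t → x ∉ convexHull ℝ (t : Set E) := by
  classical
  constructor
  · intro h t ht hwt hxt
    obtain ⟨s, ⟨hs, hws⟩, hxs⟩ := Set.mem_iUnion₂.1 h
    have hst := L.inter_subset_convexHull hs ht ⟨openSimplex_subset_convexHull s hxs, hxt⟩
    rw [← Finset.coe_inter] at hst
    obtain ⟨c, hc, hc1, hcx⟩ := hxs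
    obtain ⟨b, -, hb1, hbx⟩ := Finset.mem_convexHull'.1 hst
    have hsum : ∑ v ∈ s, (if v ∈ t then b v else 0) = 1 := by
      rw [← Finset.sum_filter, Finset.filter_mem_eq_inter, hb1]
    have hsum' : ∑ v ∈ s, (if v ∈ t then b v else 0) • v = x := by
      simp_rw [ite_smul, zero_smul]
      rw [← Finset.sum_filter, Finset.filter_mem_eq_inter, hbx]
    have := eq_zero_of_affineIndependent_coe (L.indep hs)
      (c := fun v => c v - if v ∈ t then b v else 0)
      (by rw [Finset.sum_sub_distrib, hc1, hsum, sub_self])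
      (by simp_rw [sub_smul]; rw [Finset.sum_sub_distrib, hcx, hsum', sub_self]) hws
    simp only [if_neg hwt, sub_zero] at this
    exact (hc w hws).ne' this
  · intro h
    obtain ⟨s, hs, hxs⟩ := SimplicialComplex.mem_space_iff.1 hx
    obtain ⟨t, hts, htne, hxt⟩ := exists_mem_openSimplex hxs
    have ht := L.down_closed hs hts htne
    refine Set.mem_iUnion₂.2 ⟨t, ⟨ht, ?_⟩, hxt⟩
    by_contra hw
    exact h t ht hw (openSimplex_subset_convexHull t hxt)

lemma exists_mem_openStarSpace {x : E} (hx : x ∈ L.space) :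
    ∃ w ∈ L.vertices, x ∈ openStarSpace L w := by
  obtain ⟨s, hs, hxs⟩ := SimplicialComplex.mem_space_iff.1 hx
  obtain ⟨t, hts, ⟨w, hw⟩, hxt⟩ := exists_mem_openSimplex hxs
  have ht := L.down_closed hs hts ⟨w, hw⟩
  exact ⟨w, L.down_closed ht (Finset.singleton_subset_iff.2 hw) (Finset.singleton_nonempty _),
    Set.mem_iUnion₂.2 ⟨t, ⟨ht, hw⟩, hxt⟩⟩

end OpenStars

/-! ### The Lebesgue number of the open star cover -/

section Lebesgue

/-- The Lebesgue number of the cover of a compact space by the preimages of the open stars. -/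
lemma exists_pos_ball_mapsTo_openStarSpace {X E : Type} [PseudoMetricSpace X] [CompactSpace X]
    [NormedAddCommGroup E] [NormedSpace ℝ E] (L : SimplicialComplex ℝ E)
    (hL : L.faces.Finite) {G : X → E} (hG : Continuous G) (hGL : ∀ x, G x ∈ L.space) :
    ∃ ε > 0, ∀ x, ∃ w ∈ L.vertices, MapsTo G (ball x ε) (openStarSpace L w) := by
  have hopen : ∀ w : L.vertices, IsOpen (G ⁻¹' openStarSpace L (w : E)) := by
    intro w
    have : G ⁻¹' openStarSpace L (w : E) =
        (⋃ t ∈ {t ∈ L.faces | (w : E) ∉ t}, G ⁻¹' convexHull ℝ (t : Set E))ᶜ := by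
      ext x
      simp only [mem_preimage, mem_openStarSpace_iff L (hGL x), mem_compl_iff, mem_iUnion,
        mem_ofPred_eq, exists_prop, not_exists, not_and, and_imp]
    rw [this, isOpen_compl_iff]
    exact (hL.subset fun _ h => h.1).isClosed_biUnion fun t _ =>
      (t.finite_toSet.isClosed_convexHull ℝ).preimage hG
  obtain ⟨ε, hε, h⟩ := lebesgue_number_lemma_of_metric isCompact_univ hopen (fun x _ => by
    obtain ⟨w, hw, hx⟩ := exists_mem_openStarSpace L (hGL x)
    exact mem_iUnion.2 ⟨⟨w, hw⟩, hx⟩)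
  exact ⟨ε, hε, fun x => let ⟨w, hw⟩ := h x (mem_univ _); ⟨w, w.2, hw⟩⟩

end Lebesgue

/-! ### Metric estimates for the radial projection -/

section Normalize

lemma dist_normalize_le {E : Type} [NormedAddCommGroup E] [NormedSpace ℝ E] {x v : E}
    (hv : ‖v‖ = 1) (hx : x ≠ 0) : dist (NormedSpace.normalize x) v ≤ 2 * dist x v := by
  have h1 : dist (NormedSpace.normalize x) x = |‖v‖ - ‖x‖| := by
    have hx' : ‖x‖ ≠ 0 := norm_ne_zero_iff.2 hx
    have : NormedSpace.normalize x - x = (1 - ‖x‖) • NormedSpace.normalize x := by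
      rw [sub_smul, one_smul, NormedSpace.norm_smul_normalize]
    rw [dist_eq_norm, this, norm_smul, NormedSpace.norm_normalize_eq_one_iff.2 hx, mul_one, hv,
      Real.norm_eq_abs]
  have h2 := abs_norm_sub_norm_le v x
  have h3 := dist_triangle (NormedSpace.normalize x) x v
  rw [h1] at h3
  rw [← dist_eq_norm, dist_comm] at h2
  linarith

/-- Outside the ball of radius `ρ`, the radial projection is Lipschitz with constant `ρ⁻¹`. -/
lemma mul_dist_normalize_le {E : Type} [NormedAddCommGroup E] [InnerProductSpace ℝ E] {a b : E}
    {ρ : ℝ} (hρ : 0 < ρ) (ha : ρ ≤ ‖a‖) (hb : ρ ≤ ‖b‖) :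
    ρ * dist (NormedSpace.normalize a) (NormedSpace.normalize b) ≤ dist a b := by
  have ha0 : a ≠ 0 := norm_pos_iff.1 (hρ.trans_le ha)
  have hb0 : b ≠ 0 := norm_pos_iff.1 (hρ.trans_le hb)
  have hu := NormedSpace.norm_normalize_eq_one_iff.2 ha0
  have hw := NormedSpace.norm_normalize_eq_one_iff.2 hb0
  have hau := NormedSpace.norm_smul_normalize a
  have hbw := NormedSpace.norm_smul_normalize b
  set u := NormedSpace.normalize a
  set w := NormedSpace.normalize b
  have hin : inner ℝ u w ≤ 1 := by
    have := real_inner_le_norm u w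
    rwa [hu, hw, one_mul] at this
  have e1 : dist u w ^ 2 = 2 - 2 * inner ℝ u w := by
    rw [dist_eq_norm, norm_sub_sq_real, hu, hw]; ring
  have e2 : dist a b ^ 2 = ‖a‖ ^ 2 + ‖b‖ ^ 2 - 2 * (‖a‖ * ‖b‖) * inner ℝ u w := by
    rw [dist_eq_norm, norm_sub_sq_real]
    have : inner ℝ a b = ‖a‖ * (‖b‖ * inner ℝ u w) := by
      rw [← real_inner_smul_right, ← real_inner_smul_left, hau, hbw]
    rw [this]; ring
  refine abs_le_of_sq_le_sq' ?_ dist_nonneg |>.2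
  rw [mul_pow, e1, e2]
  -- The identity behind the estimate: `dist a b ^ 2 = (‖a‖ - ‖b‖) ^ 2 + ‖a‖ * ‖b‖ * dist u w ^ 2`.
  have h3 : ρ * ρ ≤ ‖a‖ * ‖b‖ := mul_le_mul ha hb hρ.le (norm_nonneg _)
  nlinarith [sq_nonneg (‖a‖ - ‖b‖), mul_le_mul_of_nonneg_right h3 (sub_nonneg.2 hin)]

end Normalize

/-! ### Small mesh implies termination -/

section Termination

variable {E E' : Type} [NormedAddCommGroup E] [NormedSpace ℝ E]

/-- All vertices lie on the unit sphere and vertices of a common simplex have distance at most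
`D`. -/
def SphericalMeshLE (C : RealizedComplex E) (D : ℝ) : Prop :=
  ∀ s ∈ C.cx.faces, ∀ x ∈ s, ‖C.pos x‖ = 1 ∧ ∀ y ∈ s, dist (C.pos x) (C.pos y) ≤ D

lemma SphericalMeshLE.mono {E : Type} [NormedAddCommGroup E] {C : RealizedComplex E} {D D' : ℝ} (h : SphericalMeshLE C D)
    (hD : D ≤ D') : SphericalMeshLE C D' :=
  fun s hs x hx => ⟨(h s hs x hx).1, fun y hy => ((h s hs x hx).2 y hy).trans hD⟩

lemma StarCondition.exists_isWeakSimplicialApprox [AddCommGroup E'] [Module ℝ E']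
    {C : RealizedComplex E} {L : SimplicialComplex ℝ E'} {f : E → E'}
    (h : StarCondition C L f) : ∃ g, IsWeakSimplicialApprox C L f g := by
  choose g hg using fun v : C.vertices => h v v.2
  refine ⟨fun v => ⟨g v, (hg v).1⟩, fun v u hu => (hg v).2 ⟨C.pos u, ?_, rfl⟩⟩
  exact Set.mem_iUnion₂.2 ⟨{u}, hu, subset_convexHull ℝ _ ⟨u, by simp, rfl⟩⟩

/-- The run may stop before stage `n`; in either case the star condition itself supplies an output.
-/
lemma terminates_of_starCondition_iterate [AddCommGroup E'] [Module ℝ E']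
    (sub : RealizedComplex E → RealizedComplex E) (L : SimplicialComplex ℝ E') (f : E → E')
    (n : ℕ) (C : RealizedComplex E)
    (h : StarCondition ((fun C => (sub C).normalizeVertices)^[n] C) L f) :
    Terminates sub L f C := by
  induction n generalizing C with
  | zero =>
    obtain ⟨g, hg⟩ := h.exists_isWeakSimplicialApprox
    exact ⟨C, g, Run.exit C g h hg⟩
  | succ n ih =>
    by_cases hC : StarCondition C L f
    · obtain ⟨g, hg⟩ := hC.exists_isWeakSimplicialApprox
      exact ⟨C, g, Run.exit C g hC hg⟩
    · obtain ⟨C', g, hg⟩ := ih _ h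
      exact ⟨C', g, Run.loop C C' g hC hg⟩

variable [NormedAddCommGroup E'] [NormedSpace ℝ E'] [ProperSpace E]

lemma exists_starCondition_of_sphericalMeshLE (L : SimplicialComplex ℝ E') (hL : L.faces.Finite)
    {F : E → E'} (hF : ContinuousOn F (sphere 0 1)) (hFL : MapsTo F (sphere 0 1) L.space) :
    ∃ D > 0, ∀ C : RealizedComplex E, SphericalMeshLE C D →
      StarCondition C L (fun x => F (NormedSpace.normalize x)) := by
  have : CompactSpace (sphere (0 : E) 1) := isCompact_iff_compactSpace.1 (isCompact_sphere 0 1)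
  obtain ⟨ε, hε, h⟩ := exists_pos_ball_mapsTo_openStarSpace L hL (X := sphere (0 : E) 1)
    (continuousOn_iff_continuous_domRestrict.1 hF) (fun x => hFL x.2)
  -- The bound `1 / 2` keeps the closed star away from the origin; `ε / 3` absorbs the factor 2 of
  -- `dist_normalize_le` and leaves a strict inequality.
  refine ⟨min (1 / 2) (ε / 3), by positivity, fun C hC v hv => ?_⟩
  have hv1 : ‖C.pos v‖ = 1 := (hC {v} hv v (by simp)).1
  obtain ⟨w, hw, hball⟩ := h ⟨C.pos v, by simpa using hv1⟩
  refine ⟨w, hw, ?_⟩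
  rintro _ ⟨x, hx, rfl⟩
  obtain ⟨t, ⟨-, s, ⟨hs, hvs⟩, hts⟩, hxt⟩ := Set.mem_iUnion₂.1 hx
  have hsub : C.pos '' (t : Set C.V) ⊆ closedBall (C.pos v) (min (1 / 2) (ε / 3)) := by
    rintro _ ⟨y, hy, rfl⟩
    exact (hC s hs y (hts hy)).2 v hvs
  have hxv : dist x (C.pos v) ≤ min (1 / 2) (ε / 3) :=
    convexHull_min hsub (convex_closedBall _ _) hxt
  have hx0 : x ≠ 0 := by
    rintro rfl
    rw [dist_zero_left, hv1] at hxv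
    linarith [min_le_left (1 / 2 : ℝ) (ε / 3)]
  have hn := NormedSpace.norm_normalize_eq_one_iff.2 hx0
  refine hball (show (⟨NormedSpace.normalize x, by simpa using hn⟩ : sphere (0 : E) 1) ∈ _ from ?_)
  rw [mem_ball, Subtype.dist_eq]
  have := dist_normalize_le hv1 hx0
  simp only
  linarith [min_le_right (1 / 2 : ℝ) (ε / 3)]

lemma terminates_of_mesh (sub : RealizedComplex E → RealizedComplex E)
    (L : SimplicialComplex ℝ E') (hL : L.faces.Finite)
    {F : E → E'} (hF : ContinuousOn F (sphere 0 1)) (hFL : MapsTo F (sphere 0 1) L.space)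
    (C : RealizedComplex E)
    (h : ∀ D > 0, ∃ n, SphericalMeshLE ((fun C => (sub C).normalizeVertices)^[n] C) D) :
    Terminates sub L (fun x => F (NormedSpace.normalize x)) C := by
  obtain ⟨D, hD, hstar⟩ := exists_starCondition_of_sphericalMeshLE L hL hF hFL
  obtain ⟨n, hn⟩ := h D hD
  exact terminates_of_starCondition_iterate sub L _ n C (hstar _ hn)

end Termination

/-! ### The initial complex: dimension and edge lengths -/

section Initial

variable {E : Type}

/-- If the radial projection is injective on `|K|`, the vertices of every simplex are linearly
independent. -/
lemma IsRadialTriangulation.linearIndependent [NormedAddCommGroup E] [NormedSpace ℝ E]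
    {K : SimplicialComplex ℝ E} (hK : IsRadialTriangulation K) {s : Finset E}
    (hs : s ∈ K.faces) : LinearIndependent ℝ ((↑) : s → E) := by
  obtain ⟨h, hh⟩ := hK
  have hinj : ∀ x ∈ K.space, ∀ y ∈ K.space,
      NormedSpace.normalize x = NormedSpace.normalize y → x = y := by
    intro x hx y hy hxy
    have := h.injective (a₁ := ⟨x, hx⟩) (a₂ := ⟨y, hy⟩)
      (Subtype.ext (by rw [hh, hh]; exact hxy))
    exact congrArg Subtype.val this
  rw [Fintype.linearIndependent_iff]
  intro c hc
  by_cases hS : ∑ i, c i = 0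
  · exact fun i => affineIndependent_iff.1 (K.indep hs) Finset.univ c hS hc i (Finset.mem_univ _)
  -- A linear relation with nonzero coefficient sum would place two distinct points of the simplex
  -- on one ray: shift the barycentric weights along the relation, then rescale to total weight 1.
  exfalso
  have hpos : (0 : ℝ) < s.card :=
    Nat.cast_pos.2 (Finset.card_pos.2 (K.nonempty_of_mem_faces hs))
  set n : ℝ := (s.card : ℝ) with hn
  have hcard : ∑ _i : s, n⁻¹ = 1 := by
    rw [Finset.sum_const, Finset.card_univ, Fintype.card_coe, nsmul_eq_mul, ← hn,
      mul_inv_cancel₀ hpos.ne']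
  set A : ℝ := 1 + ∑ i, |c i|
  have hcA : ∀ i, |c i| ≤ A := fun i =>
    (Finset.single_le_sum (fun i _ => abs_nonneg (c i)) (Finset.mem_univ i)).trans
      (le_add_of_nonneg_left zero_le_one)
  have hA : 0 < A := add_pos_of_pos_of_nonneg one_pos (Finset.sum_nonneg fun i _ => abs_nonneg _)
  -- Small enough that every shifted weight keeps at least half of its original value `n⁻¹`.
  set t : ℝ := (2 * n * A)⁻¹
  have ht : 0 < t := by positivity
  have htc : ∀ i, n⁻¹ / 2 ≤ n⁻¹ + t * c i := by
    intro i
    have h1 : t * |c i| ≤ t * A := mul_le_mul_of_nonneg_left (hcA i) ht.le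
    have h2 : t * A = n⁻¹ / 2 := by simp only [t]; field_simp
    have h3 := mul_le_mul_of_nonneg_left (neg_abs_le (c i)) ht.le
    linarith
  have hsum : ∑ i, (n⁻¹ + t * c i) = 1 + t * ∑ i, c i := by
    rw [Finset.sum_add_distrib, hcard, Finset.mul_sum]
  set r : ℝ := 1 + t * ∑ i, c i
  have hr : 0 < r := by
    have : ∑ _i : s, n⁻¹ / 2 ≤ ∑ i, (n⁻¹ + t * c i) := Finset.sum_le_sum fun i _ => htc i
    rw [← Finset.sum_div, hcard, hsum] at this
    linarith
  set x : E := ∑ i : s, n⁻¹ • (i : E) with hxdef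
  have hx : x ∈ K.space := SimplicialComplex.mem_space_iff.2 ⟨s, hs,
    (convex_convexHull ℝ _).sum_mem (fun _ _ => by positivity) hcard
      (fun i _ => subset_convexHull ℝ _ i.2)⟩
  have hy : r⁻¹ • x ∈ K.space := by
    refine SimplicialComplex.mem_space_iff.2 ⟨s, hs, ?_⟩
    have : r⁻¹ • x = ∑ i : s, (r⁻¹ * (n⁻¹ + t * c i)) • (i : E) := by
      simp_rw [mul_smul, add_smul, mul_smul]
      rw [← Finset.smul_sum, Finset.sum_add_distrib, ← Finset.smul_sum (r := t), hc, smul_zero,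
        add_zero]
    rw [this]
    refine (convex_convexHull ℝ _).sum_mem (fun i _ => ?_) ?_
      (fun i _ => subset_convexHull ℝ _ i.2)
    · have : 0 ≤ n⁻¹ + t * c i := le_trans (by positivity) (htc i)
      positivity
    · rw [← Finset.mul_sum, hsum, inv_mul_cancel₀ hr.ne']
  have hx0 : x ≠ 0 := by
    intro h0
    have h1 : ‖(h ⟨x, hx⟩ : E)‖ = 1 := mem_sphere_zero_iff_norm.1 (h ⟨x, hx⟩).2
    rw [hh] at h1
    simp [h0] at h1
  have hxy := hinj x hx _ hy (NormedSpace.normalize_smul_of_pos (inv_pos.2 hr) x).symm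
  have h1 : (1 - r⁻¹) • x = 0 := by rw [sub_smul, one_smul, ← hxy, sub_self]
  rcases smul_eq_zero.1 h1 with h2 | h2
  · have : r = 1 := by rw [← inv_inj, inv_one]; linarith
    exact mul_ne_zero ht.ne' hS (by simpa [r] using this)
  · exact hx0 h2

lemma IsRadialTriangulation.card_le [NormedAddCommGroup E] [NormedSpace ℝ E]
    [FiniteDimensional ℝ E] {K : SimplicialComplex ℝ E} (hK : IsRadialTriangulation K)
    {s : Finset E} (hs : s ∈ K.faces) : s.card ≤ Module.finrank ℝ E := by
  have := (hK.linearIndependent hs).fintype_card_le_finrank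
  rwa [Fintype.card_coe] at this

lemma maxEdgeLength_nonneg [NormedAddCommGroup E] [NormedSpace ℝ E]
    (K : SimplicialComplex ℝ E) : 0 ≤ maxEdgeLength K := by
  refine Real.sSup_nonneg ?_
  rintro _ ⟨u, v, -, rfl⟩
  exact dist_nonneg

lemma dist_le_two_of_mem_sphere [NormedAddCommGroup E] {u v : E} (hu : u ∈ sphere (0 : E) 1)
    (hv : v ∈ sphere (0 : E) 1) : dist u v ≤ 2 := by
  have := dist_triangle u 0 v
  rw [dist_zero_right, dist_zero_left, mem_sphere_zero_iff_norm.1 hu,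
    mem_sphere_zero_iff_norm.1 hv] at this
  linarith

lemma maxEdgeLength_le_two [NormedAddCommGroup E] [NormedSpace ℝ E]
    {K : SimplicialComplex ℝ E} (hK : K.vertices ⊆ sphere 0 1) : maxEdgeLength K ≤ 2 := by
  classical
  refine Real.sSup_le ?_ zero_le_two
  rintro _ ⟨u, v, h, rfl⟩
  exact dist_le_two_of_mem_sphere
    (hK (K.down_closed h (by simp) (Finset.singleton_nonempty u)))
    (hK (K.down_closed h (by simp) (Finset.singleton_nonempty v)))

lemma dist_le_maxEdgeLength [NormedAddCommGroup E] [NormedSpace ℝ E]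
    {K : SimplicialComplex ℝ E} (hK : K.vertices ⊆ sphere 0 1) {s : Finset E} (hs : s ∈ K.faces)
    {u v : E} (hu : u ∈ s) (hv : v ∈ s) : dist u v ≤ maxEdgeLength K := by
  classical
  refine le_csSup ⟨2, ?_⟩ ⟨u, v, K.down_closed hs ?_ (Finset.insert_nonempty _ _), rfl⟩
  · rintro _ ⟨u, v, h, rfl⟩
    exact dist_le_two_of_mem_sphere
      (hK (K.down_closed h (by simp) (Finset.singleton_nonempty u)))
      (hK (K.down_closed h (by simp) (Finset.singleton_nonempty v)))
  · intro x hx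
    rcases Finset.mem_insert.1 hx with rfl | hx
    · exact hu
    · rwa [Finset.mem_singleton.1 hx]

lemma sphericalMeshLE_ofGeometric [NormedAddCommGroup E] [NormedSpace ℝ E]
    {K : SimplicialComplex ℝ E} (hK : K.vertices ⊆ sphere 0 1) (ord : LinearOrder K.vertices) :
    SphericalMeshLE (RealizedComplex.ofGeometric K ord) (maxEdgeLength K) := by
  intro s hs x hx
  exact ⟨mem_sphere_zero_iff_norm.1 (hK x.2), fun y hy => dist_le_maxEdgeLength hK hs
    (Finset.mem_map_of_mem _ hx) (Finset.mem_map_of_mem _ hy)⟩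

lemma card_le_of_mem_faces_ofGeometric [NormedAddCommGroup E] [NormedSpace ℝ E]
    [FiniteDimensional ℝ E] {K : SimplicialComplex ℝ E} (hK : IsRadialTriangulation K)
    (ord : LinearOrder K.vertices) :
    ∀ s ∈ (RealizedComplex.ofGeometric K ord).cx.faces, s.card ≤ Module.finrank ℝ E := by
  intro s hs
  exact (Finset.card_map _).symm.trans_le (hK.card_le hs)

end Initial

/-! ### Barycentric subdivision -/

section Barycentric

variable {E : Type} [NormedAddCommGroup E] [InnerProductSpace ℝ E]

/-- The barycenter of unit vectors with mutual distances at most `D` is not far inside the ball. -/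
lemma le_norm_sq_barycenter {ι : Type} {s : Finset ι} (hs : s.Nonempty) {p : ι → E} {D : ℝ}
    (h1 : ∀ i ∈ s, ‖p i‖ = 1) (hD : ∀ i ∈ s, ∀ j ∈ s, dist (p i) (p j) ≤ D) :
    1 - (1 - (s.card : ℝ)⁻¹) * (D ^ 2 / 2) ≤ ‖(s.card : ℝ)⁻¹ • ∑ i ∈ s, p i‖ ^ 2 := by
  classical
  have hpos : (0 : ℝ) < s.card := Nat.cast_pos.2 (Finset.card_pos.2 hs)
  -- The `if` term records that diagonal inner products equal 1; this gain produces the factor `1 -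
  -- (s.card)⁻¹`.
  have hin : ∀ i ∈ s, ∀ j ∈ s,
      1 - D ^ 2 / 2 + (if i = j then D ^ 2 / 2 else 0) ≤ inner ℝ (p i) (p j) := by
    intro i hi j hj
    split_ifs with hij
    · rw [← hij, real_inner_self_eq_norm_sq, h1 i hi]; linarith
    · have h2 : dist (p i) (p j) ^ 2 = 2 - 2 * inner ℝ (p i) (p j) := by
        rw [dist_eq_norm, norm_sub_sq_real, h1 i hi, h1 j hj]; ring
      have h3 := pow_le_pow_left₀ dist_nonneg (hD i hi j hj) 2
      linarith
  have hsum : (s.card : ℝ) * (s.card * (1 - D ^ 2 / 2) + D ^ 2 / 2) ≤ ‖∑ i ∈ s, p i‖ ^ 2 := by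
    rw [← real_inner_self_eq_norm_sq, sum_inner, ← nsmul_eq_mul, ← Finset.sum_const]
    refine Finset.sum_le_sum fun i hi => ?_
    rw [inner_sum]
    refine le_trans (le_of_eq ?_) (Finset.sum_le_sum fun j hj => hin i hi j hj)
    rw [Finset.sum_add_distrib, Finset.sum_const, nsmul_eq_mul, Finset.sum_ite_eq, if_pos hi]
  rw [norm_smul, mul_pow, Real.norm_eq_abs, sq_abs]
  refine le_trans (le_of_eq ?_) (mul_le_mul_of_nonneg_left hsum (by positivity))
  field_simp
  ring

/-- The ball of this radius about the barycenter of `t` contains the vertices of `t`, hence by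
convexity the barycenter of `s`. -/
lemma dist_barycenter_le {ι : Type} {s t : Finset ι} (hs : s.Nonempty) (hst : s ⊆ t) {p : ι → E}
    {D : ℝ} (hD : ∀ i ∈ t, ∀ j ∈ t, dist (p i) (p j) ≤ D) :
    dist ((s.card : ℝ)⁻¹ • ∑ i ∈ s, p i) ((t.card : ℝ)⁻¹ • ∑ i ∈ t, p i) ≤
      (1 - (t.card : ℝ)⁻¹) * D := by
  classical
  have hspos : (0 : ℝ) < s.card := Nat.cast_pos.2 (Finset.card_pos.2 hs)
  have htpos : (0 : ℝ) < t.card := Nat.cast_pos.2 (Finset.card_pos.2 (hs.mono hst))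
  have hv : ∀ i ∈ t, dist (p i) ((t.card : ℝ)⁻¹ • ∑ j ∈ t, p j) ≤ (1 - (t.card : ℝ)⁻¹) * D := by
    intro i hi
    have e : p i - (t.card : ℝ)⁻¹ • ∑ j ∈ t, p j
        = (t.card : ℝ)⁻¹ • ∑ j ∈ t.erase i, (p i - p j) := by
      rw [Finset.sum_erase _ (sub_self _), Finset.sum_sub_distrib, Finset.sum_const,
        ← Nat.cast_smul_eq_nsmul ℝ, smul_sub, inv_smul_smul₀ htpos.ne']
    have hn : ‖∑ j ∈ t.erase i, (p i - p j)‖ ≤ ((t.card : ℝ) - 1) * D := by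
      refine (norm_sum_le_of_le (n := fun _ => D) _ fun j hj => ?_).trans (le_of_eq ?_)
      · rw [← dist_eq_norm]; exact hD i hi j (Finset.mem_of_mem_erase hj)
      · rw [Finset.sum_const, nsmul_eq_mul, Finset.card_erase_of_mem hi,
          Nat.cast_pred (Finset.card_pos.2 ⟨i, hi⟩)]
    rw [dist_eq_norm, e, norm_smul, Real.norm_eq_abs, abs_of_pos (inv_pos.2 htpos)]
    refine (mul_le_mul_of_nonneg_left hn (by positivity)).trans (le_of_eq ?_)
    field_simp
  have hmem : (s.card : ℝ)⁻¹ • ∑ i ∈ s, p i ∈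
      closedBall ((t.card : ℝ)⁻¹ • ∑ i ∈ t, p i) ((1 - (t.card : ℝ)⁻¹) * D) := by
    rw [Finset.smul_sum (s := s)]
    refine (convex_closedBall _ _).sum_mem (fun _ _ => (inv_pos.2 hspos).le) ?_
      (fun i hi => hv i (hst hi))
    rw [Finset.sum_const, nsmul_eq_mul, mul_inv_cancel₀ hspos.ne']
  exact hmem

/-- All faces have at most `n` vertices. -/
def FaceCardLE (C : RealizedComplex E) (n : ℕ) : Prop := ∀ s ∈ C.cx.faces, s.card ≤ n

/-- Cardinality is injective on a chain of faces and takes values in `1, …, n`. -/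
lemma FaceCardLE.barycentric {C : RealizedComplex E} {n : ℕ} (h : FaceCardLE C n) :
    FaceCardLE C.barycentric.normalizeVertices n := by
  intro (S : Finset (Finset C.V)) hS
  obtain ⟨-, hface, hchain⟩ : _ ∧ (∀ s ∈ S, s ∈ C.cx.faces) ∧ _ := hS
  have : S.card ≤ (Finset.Icc 1 n).card := by
    refine Finset.card_le_card_of_injOn Finset.card (fun s hs => ?_) (fun s hs t ht hst => ?_)
    · exact Finset.mem_coe.2 (Finset.mem_Icc.2
        ⟨Finset.card_pos.2 (C.cx.isRelLowerSet_faces (hface s hs)).1, h s (hface s hs)⟩)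
    · by_contra hne
      rcases hchain hs ht hne with h' | h'
      · exact hne (Finset.eq_of_subset_of_card_le h' hst.ge)
      · exact hne (Finset.eq_of_subset_of_card_le h' hst.le).symm
  exact this.trans_eq (by rw [Nat.card_Icc, Nat.add_sub_cancel])

lemma one_sub_inv_card_le {ι : Type} {s : Finset ι} (hs : s.Nonempty) {d : ℕ}
    (h : s.card ≤ d + 1) : 1 - (s.card : ℝ)⁻¹ ≤ (d : ℝ) / (d + 1) := by
  have hpos : (0 : ℝ) < s.card := Nat.cast_pos.2 (Finset.card_pos.2 hs)
  have h' : (s.card : ℝ) ≤ d + 1 := by exact_mod_cast h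
  have : (d : ℝ) / (d + 1) = 1 - ((d : ℝ) + 1)⁻¹ := by field_simp; ring
  rw [this]
  gcongr

/-- One step of the algorithm with barycentric subdivisions contracts the mesh. -/
lemma SphericalMeshLE.barycentric {C : RealizedComplex E} {D ρ : ℝ} {d : ℕ}
    (h : SphericalMeshLE C D) (hC : FaceCardLE C (d + 1)) (hρ : 0 < ρ) (hD : 0 ≤ D)
    (hρD : ρ ^ 2 ≤ 1 - (d : ℝ) / (d + 1) * (D ^ 2 / 2)) :
    SphericalMeshLE C.barycentric.normalizeVertices ((d : ℝ) / (d + 1) / ρ * D) := by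
  intro (S : Finset (Finset C.V)) hS
  obtain ⟨-, hface, hchain⟩ : _ ∧ (∀ s ∈ S, s ∈ C.cx.faces) ∧ _ := hS
  have hne : ∀ s ∈ S, s.Nonempty := fun s hs => (C.cx.isRelLowerSet_faces (hface s hs)).1
  have hcard : ∀ s ∈ S, 1 - (s.card : ℝ)⁻¹ ≤ (d : ℝ) / (d + 1) := fun s hs =>
    one_sub_inv_card_le (hne s hs) (hC s (hface s hs))
  have hnorm : ∀ s ∈ S, ρ ≤ ‖(s.card : ℝ)⁻¹ • ∑ i ∈ s, C.pos i‖ := by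
    intro s hs
    refine abs_le_of_sq_le_sq' ?_ (norm_nonneg _) |>.2
    refine le_trans ?_ (le_norm_sq_barycenter (hne s hs)
      (fun i hi => (h s (hface s hs) i hi).1) (fun i hi => (h s (hface s hs) i hi).2))
    have := mul_le_mul_of_nonneg_right (hcard s hs) (by positivity : 0 ≤ D ^ 2 / 2)
    linarith
  have hdist : ∀ s ∈ S, ∀ t ∈ S, s ⊆ t →
      dist (NormedSpace.normalize ((s.card : ℝ)⁻¹ • ∑ i ∈ s, C.pos i))
        (NormedSpace.normalize ((t.card : ℝ)⁻¹ • ∑ i ∈ t, C.pos i)) ≤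
        (d : ℝ) / (d + 1) / ρ * D := by
    intro s hs t ht hst
    have h1 := mul_dist_normalize_le hρ (hnorm s hs) (hnorm t ht)
    have h2 := dist_barycenter_le (hne s hs) hst (fun i hi => (h t (hface t ht) i hi).2)
    have h3 := mul_le_mul_of_nonneg_right (hcard t ht) hD
    rw [div_mul_eq_mul_div, le_div_iff₀ hρ, mul_comm _ ρ]
    exact h1.trans (h2.trans h3)
  intro s hs
  refine ⟨NormedSpace.norm_normalize_eq_one_iff.2
    (norm_pos_iff.1 (hρ.trans_le (hnorm s hs))), fun t ht => ?_⟩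
  by_cases hst : s = t
  · subst hst
    rw [dist_self]
    positivity
  · rcases hchain hs ht hst with h' | h'
    · exact hdist s hs t ht h'
    · rw [dist_comm]; exact hdist t ht s hs h'

/-- The mesh bound never exceeds its initial value `D`, so the lower bound `ρ` for the barycenters
remains valid at every stage. -/
lemma SphericalMeshLE.barycentric_iterate {C : RealizedComplex E} {D ρ : ℝ} {d : ℕ}
    (h : SphericalMeshLE C D) (hC : FaceCardLE C (d + 1)) (hD : 0 ≤ D)
    (hρ : (d : ℝ) / (d + 1) < ρ)
    (hρD : ρ ^ 2 ≤ 1 - (d : ℝ) / (d + 1) * (D ^ 2 / 2)) (n : ℕ) :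
    SphericalMeshLE ((fun C : RealizedComplex E => C.barycentric.normalizeVertices)^[n] C)
      (((d : ℝ) / (d + 1) / ρ) ^ n * D) := by
  have hρ0 : 0 < ρ := lt_of_le_of_lt (by positivity) hρ
  have hq1 : (d : ℝ) / (d + 1) / ρ ≤ 1 := (div_le_one hρ0).2 hρ.le
  have hq0 : 0 ≤ (d : ℝ) / (d + 1) / ρ := by positivity
  suffices ∀ n, SphericalMeshLE
      ((fun C : RealizedComplex E => C.barycentric.normalizeVertices)^[n] C)
      (((d : ℝ) / (d + 1) / ρ) ^ n * D) ∧
      FaceCardLE ((fun C : RealizedComplex E => C.barycentric.normalizeVertices)^[n] C) (d + 1) from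
    (this n).1
  intro n
  induction n with
  | zero => simpa using ⟨h, hC⟩
  | succ n ih =>
    rw [Function.iterate_succ_apply', pow_succ', mul_assoc]
    refine ⟨ih.1.barycentric ih.2 hρ0 (by positivity) (hρD.trans ?_), ih.2.barycentric⟩
    have h1 : ((d : ℝ) / (d + 1) / ρ) ^ n * D ≤ D :=
      mul_le_of_le_one_left hD (pow_le_one₀ hq0 hq1)
    have h2 : (((d : ℝ) / (d + 1) / ρ) ^ n * D) ^ 2 ≤ D ^ 2 :=
      pow_le_pow_left₀ (by positivity) h1 2
    have h3 : 0 ≤ (d : ℝ) / (d + 1) := by positivity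
    nlinarith

lemma ell_le_of_inv_mul_lt {d : ℕ} {δ c : ℝ} (hδ : 0 ≤ δ) (h : δ⁻¹ * ell d δ < c) :
    ell d δ ≤ c * δ := by
  rcases hδ.eq_or_lt with rfl | hδ
  · simp [ell]
  · have := mul_lt_mul_of_pos_right h hδ
    rw [mul_comm, mul_inv_cancel_left₀ hδ.ne'] at this
    exact this.le

lemma exists_sphericalMeshLE_barycentric {C : RealizedComplex E} {δ : ℝ} {d : ℕ}
    (h : SphericalMeshLE C δ) (hC : FaceCardLE C (d + 1)) (hδ : 0 ≤ δ) (hδ2 : δ ≤ 2)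
    (hell : δ⁻¹ * ell d δ < 1 / (2 * ((d : ℝ) + 1))) {D : ℝ} (hD : 0 < D) :
    ∃ n, SphericalMeshLE
      ((fun C : RealizedComplex E => C.barycentric.normalizeVertices)^[n] C) D := by
  set ρ := √(1 - 1 / 2 * ((d : ℝ) / (d + 1)) * δ ^ 2) with hρ
  have he : ell d δ = 1 - ρ := rfl
  have hρd : (d : ℝ) / (d + 1) < ρ := by
    have e : (d : ℝ) / (d + 1) = 1 - 1 / (d + 1) := by field_simp; ring
    have hd : (0 : ℝ) < 1 / (d + 1) := by positivity
    rcases hδ.eq_or_lt with rfl | hδ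
    · have : ρ = 1 := by simp [hρ]
      linarith
    · have h1 := mul_lt_mul_of_pos_right hell hδ
      rw [mul_comm, mul_inv_cancel_left₀ hδ.ne'] at h1
      -- Chords of the unit sphere have length at most 2, so the hypothesis gives `1 - ρ < 1 / (d +
      -- 1)`.
      have h2 : 1 / (2 * ((d : ℝ) + 1)) * δ ≤ 1 / (2 * ((d : ℝ) + 1)) * 2 := by gcongr
      have h3 : 1 / (2 * ((d : ℝ) + 1)) * 2 = 1 / (d + 1) := by field_simp
      linarith
  have hρ0 : 0 < ρ := lt_of_le_of_lt (by positivity) hρd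
  have hρD : ρ ^ 2 ≤ 1 - (d : ℝ) / (d + 1) * (δ ^ 2 / 2) := by
    rw [hρ, Real.sq_sqrt (Real.sqrt_pos.1 hρ0).le]
    linarith
  have hq1 : (d : ℝ) / (d + 1) / ρ < 1 := (div_lt_one hρ0).2 hρd
  have hlim := (tendsto_pow_atTop_nhds_zero_of_lt_one (by positivity) hq1).mul_const δ
  rw [zero_mul] at hlim
  obtain ⟨n, hn⟩ := (hlim.eventually_le_const hD).exists
  exact ⟨n, (h.barycentric_iterate hC hδ hρd hρD n).mono hn⟩

end Barycentric

/-! ### Edgewise subdivision -/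

section Edgewise

variable {E : Type} [NormedAddCommGroup E]

/-- The vertices are unit vectors, `u⁻¹` bounds the squared edge lengths and `a * u⁻¹` the squared
lengths of the monotone vertex paths in a simplex. -/
structure SphericalPathLE (C : RealizedComplex E) (u a : ℝ) : Prop where
  norm_eq_one : ∀ s ∈ C.cx.faces, ∀ x ∈ s, ‖C.pos x‖ = 1
  edge : ∀ s ∈ C.cx.faces, ∀ x ∈ s, ∀ y ∈ s, dist (C.pos x) (C.pos y) ^ 2 * u ≤ 1
  path : ∀ s ∈ C.cx.faces, ∀ f : ℕ → C.V, Monotone f → (∀ i, f i ∈ s) → ∀ n,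
    (∑ i ∈ Finset.range n, dist (C.pos (f i)) (C.pos (f (i + 1)))) ^ 2 * u ≤ a

namespace SphericalPathLE

variable {C : RealizedComplex E} {u a : ℝ}

lemma mono {b : ℝ} (h : SphericalPathLE C u a) (hab : a ≤ b) : SphericalPathLE C u b :=
  ⟨h.norm_eq_one, h.edge, fun s hs f hf hfs n => (h.path s hs f hf hfs n).trans hab⟩

/-- Edges are paths. -/
lemma of_path (h : SphericalPathLE C u a) (ha : 0 < a) : SphericalPathLE C (u / a) 1 := by
  have hpath : ∀ s ∈ C.cx.faces, ∀ f : ℕ → C.V, Monotone f → (∀ i, f i ∈ s) → ∀ n,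
      (∑ i ∈ Finset.range n, dist (C.pos (f i)) (C.pos (f (i + 1)))) ^ 2 * (u / a) ≤ 1 := by
    intro s hs f hf hfs n
    rw [← mul_div_assoc, div_le_one ha]
    exact h.path s hs f hf hfs n
  have hle : ∀ s ∈ C.cx.faces, ∀ x ∈ s, ∀ y ∈ s, x ≤ y →
      dist (C.pos x) (C.pos y) ^ 2 * (u / a) ≤ 1 := by
    intro s hs x hx y hy hxy
    -- An edge is the path that jumps from `x` to `y` and then stays there.
    have := hpath s hs (fun i => if i = 0 then x else y) ?_ ?_ 1
    · simpa using this
    · refine monotone_nat_of_le_succ fun i => ?_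
      by_cases hi : i = 0
      · simpa [hi] using hxy
      · simp [hi]
    · intro i
      split_ifs <;> assumption
  refine ⟨h.norm_eq_one, fun s hs x hx y hy => ?_, hpath⟩
  by_cases hxy : x = y
  · simp [hxy]
  rcases C.isChain s hs hx hy hxy with h' | h'
  · exact hle s hs x hx y hy h'
  · rw [dist_comm]; exact hle s hs y hy x hx h'

lemma sphericalMeshLE (h : SphericalPathLE C u a) {D : ℝ} (hu : 0 < u) (hD : 0 ≤ D)
    (huD : 1 ≤ D ^ 2 * u) : SphericalMeshLE C D := by
  refine fun s hs x hx => ⟨h.norm_eq_one s hs x hx, fun y hy => ?_⟩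
  exact abs_le_of_sq_le_sq' (le_of_mul_le_mul_right ((h.edge s hs x hx y hy).trans huD) hu) hD |>.2

end SphericalPathLE

/-- The coordinate paths of a monotone path in a simplex of the edgewise subdivision fit together
to a monotone path in the subdivided simplex. -/
lemma SphericalPathLE.path_add_path {C : RealizedComplex E} {u a : ℝ} (h : SphericalPathLE C u a)
    (hu : 0 ≤ u) {s : Finset C.V} (hs : s ∈ C.cx.faces) {x y : ℕ → C.V} (hx : Monotone x)
    (hy : Monotone y) (hxs : ∀ i, x i ∈ s) (hys : ∀ i, y i ∈ s) (hxy : ∀ i j, x i ≤ y j) (n : ℕ) :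
    (∑ i ∈ Finset.range n, (dist (C.pos (x i)) (C.pos (x (i + 1))) +
      dist (C.pos (y i)) (C.pos (y (i + 1))))) ^ 2 * u ≤ a := by
  -- The `n + 1` points of the first path come before those of the second. The edge from `x n` to `y
  -- 0` only adds length, so it can be discarded.
  set g : ℕ → C.V := fun i => if i ≤ n then x i else y (i - (n + 1)) with hg
  have hgx : ∀ i ≤ n, g i = x i := fun i hi => if_pos hi
  have hgy : ∀ i, g (n + 1 + i) = y i := fun i => by
    rw [hg]; dsimp only; rw [if_neg (by omega), Nat.add_sub_cancel_left]
  have hmono : Monotone g := by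
    refine monotone_nat_of_le_succ fun i => ?_
    rcases lt_trichotomy i n with hi | rfl | hi
    · rw [hgx i hi.le, hgx (i + 1) hi]; exact hx (Nat.le_succ i)
    · rw [hgx i le_rfl, hgy 0]; exact hxy _ _
    · obtain ⟨k, rfl⟩ := Nat.exists_eq_add_of_lt hi
      rw [show n + k + 1 = n + 1 + k by omega, hgy, show n + 1 + k + 1 = n + 1 + (k + 1) by omega,
        hgy]
      exact hy (Nat.le_succ k)
  have hgs : ∀ i, g i ∈ s := by
    intro i
    rw [hg]; dsimp only
    split_ifs
    exacts [hxs _, hys _]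
  refine le_trans (mul_le_mul_of_nonneg_right (pow_le_pow_left₀
    (Finset.sum_nonneg fun i _ => by positivity) ?_ 2) hu) (h.path s hs g hmono hgs (n + 1 + n))
  rw [Finset.sum_range_add, Finset.sum_range_succ, Finset.sum_add_distrib]
  have e1 : ∑ i ∈ Finset.range n, dist (C.pos (g i)) (C.pos (g (i + 1))) =
      ∑ i ∈ Finset.range n, dist (C.pos (x i)) (C.pos (x (i + 1))) := by
    refine Finset.sum_congr rfl fun i hi => ?_
    rw [hgx i (Finset.mem_range.1 hi).le, hgx (i + 1) (Finset.mem_range.1 hi)]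
  have e2 : ∑ i ∈ Finset.range n, dist (C.pos (g (n + 1 + i))) (C.pos (g (n + 1 + i + 1))) =
      ∑ i ∈ Finset.range n, dist (C.pos (y i)) (C.pos (y (i + 1))) := by
    refine Finset.sum_congr rfl fun i _ => ?_
    rw [hgy i, add_assoc, hgy (i + 1)]
  rw [e1, e2]
  have := dist_nonneg (x := C.pos (g n)) (y := C.pos (g (n + 1)))
  linarith

/-- A monotone path in a simplex with at most `d + 1` vertices has at most `d` edges. -/
lemma sum_dist_le_of_monotone {C : RealizedComplex E} {δ : ℝ} {d : ℕ} (hδ : 0 ≤ δ)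
    {s : Finset C.V} (hs : s.card ≤ d + 1)
    (h : ∀ x ∈ s, ∀ y ∈ s, dist (C.pos x) (C.pos y) ≤ δ) {f : ℕ → C.V} (hf : Monotone f)
    (hfs : ∀ i, f i ∈ s) (n : ℕ) :
    ∑ i ∈ Finset.range n, dist (C.pos (f i)) (C.pos (f (i + 1))) ≤ d * δ := by
  classical
  -- Each strict step arrives at a new vertex, never at `f 0`; excluding `f 0` gives `d` rather than
  -- `d + 1`.
  have hcard : ((Finset.range n).filter fun i => f i ≠ f (i + 1)).card ≤ (s.erase (f 0)).card := by
    refine Finset.card_le_card_of_injOn (fun i => f (i + 1)) (fun i hi => ?_) ?_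
    · have hlt := (hf (Nat.le_succ i)).lt_of_ne (Finset.mem_filter.1 hi).2
      exact Finset.mem_coe.2 (Finset.mem_erase.2
        ⟨((hf (Nat.zero_le i)).trans_lt hlt).ne', hfs _⟩)
    · have hlt : ∀ i j, f j ≠ f (j + 1) → i < j → f (i + 1) ≠ f (j + 1) := fun i j hj hij =>
        ((hf (Nat.succ_le_of_lt hij)).trans_lt ((hf (Nat.le_succ j)).lt_of_ne hj)).ne
      intro i hi j hj hij
      rcases lt_trichotomy i j with h' | h' | h'
      · exact absurd hij (hlt i j (Finset.mem_filter.1 hj).2 h')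
      · exact h'
      · exact absurd hij.symm (hlt j i (Finset.mem_filter.1 hi).2 h')
  rw [Finset.card_erase_of_mem (hfs 0)] at hcard
  rw [← Finset.sum_filter_of_ne (p := fun i => f i ≠ f (i + 1))]
  · refine (Finset.sum_le_card_nsmul _ _ δ fun i _ => h _ (hfs _) _ (hfs _)).trans ?_
    rw [nsmul_eq_mul]
    refine mul_le_mul_of_nonneg_right ?_ hδ
    exact Nat.cast_le.2 (hcard.trans (Nat.sub_le_of_le_add hs))
  · intro i _ hne heq
    exact hne (by rw [heq, dist_self])

lemma SphericalMeshLE.sphericalPathLE {C : RealizedComplex E} {δ u : ℝ} {d : ℕ}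
    (h : SphericalMeshLE C δ) (hC : FaceCardLE C (d + 1)) (hδ : 0 ≤ δ) (hu : 0 ≤ u)
    (hδu : δ ^ 2 * u ≤ 1) : SphericalPathLE C u ((d : ℝ) ^ 2) := by
  refine ⟨fun s hs x hx => (h s hs x hx).1, fun s hs x hx y hy => ?_, fun s hs f hf hfs n => ?_⟩
  · exact (mul_le_mul_of_nonneg_right
      (pow_le_pow_left₀ dist_nonneg ((h s hs x hx).2 y hy) 2) hu).trans hδu
  · have h1 := sum_dist_le_of_monotone hδ (hC s hs) (fun x hx => (h s hs x hx).2) hf hfs n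
    have h2 := mul_le_mul_of_nonneg_right
      (pow_le_pow_left₀ (Finset.sum_nonneg fun i _ => dist_nonneg) h1 2) hu
    refine h2.trans ?_
    rw [mul_pow, mul_assoc]
    exact mul_le_of_le_one_right (by positivity) hδu

variable [InnerProductSpace ℝ E]

lemma dist_midpoint_le (a b c d : E) :
    dist (midpoint ℝ a b) (midpoint ℝ c d) ≤ (dist a c + dist b d) / 2 := by
  exact dist_midpoint_midpoint_le a b c d

lemma norm_sq_midpoint {a b : E} (ha : ‖a‖ = 1) (hb : ‖b‖ = 1) :
    ‖midpoint ℝ a b‖ ^ 2 = 1 - dist a b ^ 2 / 4 := by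
  rw [midpoint_eq_smul_add, norm_smul, mul_pow, norm_add_sq_real, dist_eq_norm, norm_sub_sq_real,
    ha, hb]
  norm_num
  ring

/-- One step of the algorithm with edgewise subdivisions. -/
lemma SphericalPathLE.edgewise {C : RealizedComplex E} {u a : ℝ} (h : SphericalPathLE C u a)
    (hu : 1 / 4 < u) : SphericalPathLE C.edgewise.normalizeVertices (u - 1 / 4) (a / 4) := by
  classical
  have hu0 : 0 < u := by linarith
  set ρ := √(1 - (4 * u)⁻¹) with hρdef
  have hρ1 : 0 < 1 - (4 * u)⁻¹ := sub_pos.2 (inv_lt_one_of_one_lt₀ (by linarith))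
  have hρ : 0 < ρ := Real.sqrt_pos.2 hρ1
  -- Dividing lengths by `ρ` is thus a mere subtraction in the reciprocal square `u`, which is why
  -- bounds are recorded by `u`.
  have hρu : ρ ^ 2 * u = u - 1 / 4 := by
    rw [hρdef, Real.sq_sqrt hρ1.le]; field_simp
  have hnorm : ∀ s ∈ C.cx.faces, ∀ x ∈ s, ∀ y ∈ s,
      ρ ≤ ‖midpoint ℝ (C.pos x) (C.pos y)‖ := by
    intro s hs x hx y hy
    refine abs_le_of_sq_le_sq' ?_ (norm_nonneg _) |>.2
    rw [norm_sq_midpoint (h.norm_eq_one s hs x hx) (h.norm_eq_one s hs y hy), hρdef,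
      Real.sq_sqrt hρ1.le]
    have h1 := (le_div_iff₀ hu0).2 (h.edge s hs x hx y hy)
    have h2 : (4 * u)⁻¹ = 1 / u / 4 := by field_simp
    linarith
  have hdist : ∀ s ∈ C.cx.faces, ∀ x ∈ s, ∀ y ∈ s, ∀ x' ∈ s, ∀ y' ∈ s,
      ρ * dist (NormedSpace.normalize (midpoint ℝ (C.pos x) (C.pos y)))
        (NormedSpace.normalize (midpoint ℝ (C.pos x') (C.pos y'))) ≤
      (dist (C.pos x) (C.pos x') + dist (C.pos y) (C.pos y')) / 2 :=
    fun s hs x hx y hy x' hx' y' hy' =>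
      (mul_dist_normalize_le hρ (hnorm s hs x hx y hy) (hnorm s hs x' hx' y' hy')).trans
        (dist_midpoint_le _ _ _ _)
  have hbase : ∀ S ∈ C.edgewise.normalizeVertices.cx.faces, ∃ s ∈ C.cx.faces,
      (∀ p : C.V × C.V, p ∈ (S : Finset (C.V × C.V)) → p.1 ∈ s ∧ p.2 ∈ s) ∧
      ∀ p : C.V × C.V, p ∈ (S : Finset (C.V × C.V)) →
        ∀ q : C.V × C.V, q ∈ (S : Finset (C.V × C.V)) → p.1 ≤ q.2 := by
    intro S hS
    obtain ⟨-, hf, -, hle⟩ := hS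
    refine ⟨_, hf, fun p hp => ⟨?_, ?_⟩, hle⟩
    · exact Finset.mem_union_left _ (Finset.mem_image_of_mem Prod.fst hp)
    · exact Finset.mem_union_right _ (Finset.mem_image_of_mem Prod.snd hp)
  refine ⟨fun S hS p hp => ?_, fun S hS p hp q hq => ?_, fun S hS f hf hfS n => ?_⟩
  · obtain ⟨s, hs, hmem, -⟩ := hbase S hS
    exact NormedSpace.norm_normalize_eq_one_iff.2
      (norm_pos_iff.1 (hρ.trans_le (hnorm s hs _ (hmem p hp).1 _ (hmem p hp).2)))
  · obtain ⟨s, hs, hmem, -⟩ := hbase S hS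
    have h1 := hdist s hs _ (hmem p hp).1 _ (hmem p hp).2 _ (hmem q hq).1 _ (hmem q hq).2
    have h2 := h.edge s hs _ (hmem p hp).1 _ (hmem q hq).1
    have h3 := h.edge s hs _ (hmem p hp).2 _ (hmem q hq).2
    have h4 := mul_le_mul_of_nonneg_right (pow_le_pow_left₀ (by positivity) h1 2) hu0.le
    rw [← hρu]
    refine le_trans (le_of_eq_of_le ?_ h4) ?_
    · rw [mul_pow]; simp only [RealizedComplex.normalizeVertices, RealizedComplex.edgewise]; ring
    -- Convexity of the square: averaging two edges does not exceed the edge bound, but gains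
    -- nothing either.
    · have h5 : ∀ A B : ℝ, ((A + B) / 2) ^ 2 * u ≤ (A ^ 2 * u + B ^ 2 * u) / 2 := fun A B => by
        nlinarith [mul_nonneg hu0.le (sq_nonneg (A - B))]
      exact (h5 _ _).trans (by linarith)
  · obtain ⟨s, hs, hmem, hle⟩ := hbase S hS
    set x : ℕ → C.V := fun i => Prod.fst (α := C.V) (β := C.V) (f i)
    set y : ℕ → C.V := fun i => Prod.snd (α := C.V) (β := C.V) (f i)
    have hxs : ∀ i, x i ∈ s := fun i => (hmem _ (hfS i)).1
    have hys : ∀ i, y i ∈ s := fun i => (hmem _ (hfS i)).2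
    have h1 := h.path_add_path hu0.le hs (x := x) (y := y) (fun i j hij => (hf hij).1)
      (fun i j hij => (hf hij).2) hxs hys (fun i j => hle _ (hfS i) _ (hfS j)) n
    have h2 : ρ * ∑ i ∈ Finset.range n,
        dist (C.edgewise.normalizeVertices.pos (f i))
          (C.edgewise.normalizeVertices.pos (f (i + 1))) ≤
        (∑ i ∈ Finset.range n, (dist (C.pos (x i)) (C.pos (x (i + 1))) +
          dist (C.pos (y i)) (C.pos (y (i + 1))))) / 2 := by
      rw [Finset.mul_sum, Finset.sum_div]
      exact Finset.sum_le_sum fun i _ => hdist s hs _ (hxs i) _ (hys i) _ (hxs _) _ (hys _)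
    have h3 := mul_le_mul_of_nonneg_right (pow_le_pow_left₀
      (mul_nonneg hρ.le (Finset.sum_nonneg fun i _ => dist_nonneg)) h2 2) hu0.le
    rw [← hρu]
    refine le_trans (le_of_eq_of_le ?_ h3) ?_
    · rw [mul_pow]; ring
    · rw [div_pow]; linarith

lemma SphericalPathLE.edgewise_iterate {C : RealizedComplex E} {u a : ℝ}
    (h : SphericalPathLE C u a) (n : ℕ) (hu : (n : ℝ) / 4 < u) :
    SphericalPathLE ((fun C : RealizedComplex E => C.edgewise.normalizeVertices)^[n] C)
      (u - n / 4) (a / 4 ^ n) := by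
  induction n with
  | zero => simpa using h
  | succ n ih =>
    push_cast at hu ⊢
    rw [Function.iterate_succ_apply']
    have := (ih (by linarith)).edgewise (by linarith)
    convert this using 1
    · ring
    · rw [pow_succ, div_div]

/-- Once the squared edge lengths are bounded by a number less than `3`, the meshes tend to `0`. -/
lemma SphericalPathLE.exists_sphericalMeshLE_edgewise {C : RealizedComplex E} {u : ℝ}
    (h : SphericalPathLE C u 1) (hu : 1 / 3 < u) {D : ℝ} (hD : 0 < D) :
    ∃ n, SphericalMeshLE
      ((fun C : RealizedComplex E => C.edgewise.normalizeVertices)^[n] C) D := by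
  -- A step followed by `of_path` replaces `u` by `(u - 1/4) / (1/4) = 4u - 1`, whose repelling
  -- fixed point is `1/3`.
  have key : ∀ n : ℕ, SphericalPathLE
      ((fun C : RealizedComplex E => C.edgewise.normalizeVertices)^[n] C)
      (1 / 3 + 4 ^ n * (u - 1 / 3)) 1 := by
    intro n
    induction n with
    | zero => simpa using h
    | succ n ih =>
      rw [Function.iterate_succ_apply']
      have h4 : (1 : ℝ) ≤ 4 ^ n := one_le_pow₀ (by norm_num)
      have := (ih.edgewise (by nlinarith)).of_path (by norm_num)
      convert this using 1
      rw [pow_succ]; ring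
  obtain ⟨n, hn⟩ := pow_unbounded_of_one_lt (1 / (D ^ 2 * (u - 1 / 3))) (by norm_num : (1 : ℝ) < 4)
  have hu' : 0 < u - 1 / 3 := by linarith
  refine ⟨n, (key n).sphericalMeshLE (by positivity) hD.le ?_⟩
  rw [div_lt_iff₀ (by positivity)] at hn
  have : 0 < D ^ 2 := by positivity
  linarith

/-- This is `√(1 - 2y) ≤ 1 - y` for `y = d / (d + 1) * δ ^ 2 / 4`, where `δ ≤ 2` ensures `y ≤ 1`. -/
lemma le_ell {d : ℕ} {δ : ℝ} (hδ : 0 ≤ δ) (hδ2 : δ ≤ 2) :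
    (d : ℝ) / (d + 1) * δ ^ 2 / 4 ≤ ell d δ := by
  have h1 : (d : ℝ) / (d + 1) ≤ 1 := (div_le_one (by positivity)).2 (by linarith)
  have h0 : 0 ≤ (d : ℝ) / (d + 1) := by positivity
  have h3 : (d : ℝ) / (d + 1) * δ ^ 2 ≤ 4 := by nlinarith
  have h2 : √(1 - 1 / 2 * ((d : ℝ) / (d + 1)) * δ ^ 2) ≤ 1 - (d : ℝ) / (d + 1) * δ ^ 2 / 4 := by
    refine Real.sqrt_le_iff.2 ⟨by linarith, ?_⟩
    nlinarith [sq_nonneg ((d : ℝ) / (d + 1) * δ ^ 2)]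
  rw [ell]
  linarith

/-- For `d = 1` the estimate `le_ell` would yield only `u = 1/4`, below the threshold `1/3`.
Squaring the exact inequality gives `δ ≤ 8/5`, and `25/64 > 1/3`. -/
lemma sq_mul_le_one_of_ell_one_le {δ : ℝ} (hδ2 : δ ≤ 2) (h : ell 1 δ ≤ 1 / 4 * δ) :
    δ ^ 2 * (25 / 64) ≤ 1 := by
  have h1 : 1 - 1 / 4 * δ ≤ √(1 - 1 / 2 * (((1 : ℕ) : ℝ) / ((1 : ℕ) + 1)) * δ ^ 2) := by
    rw [ell] at h; linarith
  rw [Real.le_sqrt' (by linarith)] at h1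
  norm_num at h1
  have h2 : δ ≤ 8 / 5 := by
    by_contra! hlt
    nlinarith
  nlinarith

/-- Since `d / (d + 1) ≥ 2/3`, `le_ell` gives `δ² / 6 ≤ δ / (2s)`, hence `δ * s ≤ 3`. It is applied
with `s = log₂ d + 2`. -/
lemma sq_mul_le_one_of_ell_le {δ s : ℝ} {d : ℕ} (hd : 2 ≤ d) (hδ : 0 ≤ δ) (hδ2 : δ ≤ 2)
    (hs : 0 < s) (h : ell d δ ≤ 1 / (2 * s) * δ) : δ ^ 2 * (s ^ 2 / 9) ≤ 1 := by
  have hd' : (2 : ℝ) / 3 ≤ d / (d + 1) := by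
    have : (2 : ℝ) ≤ d := by exact_mod_cast hd
    rw [div_le_div_iff₀ (by norm_num) (by positivity)]
    linarith
  have h1 := (le_ell hδ hδ2).trans h
  have h2 : δ * s ≤ 3 := by
    rcases hδ.eq_or_lt with rfl | hδ
    · norm_num
    have h3 : 2 / 3 * δ ^ 2 / 4 ≤ 1 / (2 * s) * δ := le_trans (by gcongr) h1
    rw [div_mul_eq_mul_div (1 : ℝ), one_mul, le_div_iff₀ (by positivity)] at h3
    have h4 : δ * (δ * s) ≤ δ * 3 := by linarith
    exact le_of_mul_le_mul_left h4 hδ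
  have : (δ * s) ^ 2 ≤ 3 ^ 2 := pow_le_pow_left₀ (by positivity) h2 2
  linarith

lemma exists_sphericalMeshLE_edgewise {C : RealizedComplex E} {δ : ℝ} {d : ℕ} (hd : 1 ≤ d)
    (h : SphericalMeshLE C δ) (hC : FaceCardLE C (d + 1)) (hδ : 0 ≤ δ) (hδ2 : δ ≤ 2)
    (hell : δ⁻¹ * ell d δ < 1 / 4 * (Real.log d / (2 * Real.log 2) + 1)⁻¹) {D : ℝ} (hD : 0 < D) :
    ∃ n, SphericalMeshLE
      ((fun C : RealizedComplex E => C.edgewise.normalizeVertices)^[n] C) D := by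
  have hell' := ell_le_of_inv_mul_lt hδ hell
  rcases hd.eq_or_lt with rfl | hd
  · simp only [Nat.cast_one, Real.log_one, zero_div, zero_add, inv_one, mul_one] at hell'
    have h1 := h.sphericalPathLE hC hδ (by norm_num) (sq_mul_le_one_of_ell_one_le hδ2 hell')
    simp only [Nat.cast_one, one_pow] at h1
    exact h1.exists_sphericalMeshLE_edgewise (by norm_num) hD
  · have hd2 : (2 : ℝ) ≤ d := by exact_mod_cast hd
    have hlog2 : 0 < Real.log 2 := Real.log_pos one_lt_two
    set s : ℝ := Real.logb 2 d + 2 with hs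
    have hs3 : 3 ≤ s := by
      have : (1 : ℝ) ≤ Real.logb 2 d := by
        rw [Real.le_logb_iff_rpow_le one_lt_two (by linarith), Real.rpow_one]
        exact hd2
      linarith
    have hc : 1 / 4 * (Real.log d / (2 * Real.log 2) + 1)⁻¹ = 1 / (2 * s) := by
      have : Real.log d / (2 * Real.log 2) + 1 = s / 2 := by
        rw [hs, Real.logb]; field_simp
      rw [this]; field_simp; norm_num
    rw [hc] at hell'
    have h1 := h.sphericalPathLE hC hδ (by positivity)
      (sq_mul_le_one_of_ell_le hd hδ hδ2 (by linarith) hell')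
    set k := ⌈Real.logb 2 d⌉₊
    have hk1 : (k : ℝ) < s - 1 := by
      have := Nat.ceil_lt_add_one (show 0 ≤ Real.logb 2 d by linarith)
      linarith
    have hk2 : (d : ℝ) ≤ 2 ^ k := by
      have := Nat.le_ceil (Real.logb 2 d)
      rwa [Real.logb_le_iff_le_rpow one_lt_two (by linarith), Real.rpow_natCast] at this
    -- As `k < s - 1`, the right side exceeds `s² / 9 - (s - 1) / 4`, which is at least `1/2` for `s
    -- ≥ 3`.
    have hk3 : 1 / 3 < s ^ 2 / 9 - k / 4 := by nlinarith
    have h2 := (h1.edgewise_iterate k (by linarith)).mono (b := 1) (by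
      rw [div_le_one (by positivity), show (4 : ℝ) = 2 ^ 2 by norm_num, pow_right_comm]
      exact pow_le_pow_left₀ (by positivity) hk2 2)
    obtain ⟨n, hn⟩ := h2.exists_sphericalMeshLE_edgewise hk3 hD
    rw [← Function.iterate_add_apply] at hn
    exact ⟨n + k, hn⟩

end Edgewise

end SphereApprox

theorem mainTheorem5 (d m : ℕ) (hd : 1 ≤ d)
    (K : Geometry.SimplicialComplex ℝ (EuclideanSpace ℝ (Fin (d + 1))))
    (hKfin : K.faces.Finite)
    (hKvert : K.vertices ⊆ Metric.sphere (0 : EuclideanSpace ℝ (Fin (d + 1))) 1)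
    (hKrad : SphereApprox.IsRadialTriangulation K)
    (ord : LinearOrder K.vertices)
    (L : Geometry.SimplicialComplex ℝ (EuclideanSpace ℝ (Fin m)))
    (hLfin : L.faces.Finite)
    (F : EuclideanSpace ℝ (Fin (d + 1)) → EuclideanSpace ℝ (Fin m))
    (hFcont : ContinuousOn F (Metric.sphere 0 1))
    (hFmaps : Set.MapsTo F (Metric.sphere 0 1) L.space)
    (δ : ℝ) (hδ : δ = SphereApprox.maxEdgeLength K) :
    (δ⁻¹ * SphereApprox.ell d δ < 1 / (2 * ((d : ℝ) + 1)) →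
      SphereApprox.Terminates SphereApprox.RealizedComplex.barycentric L
        (fun x => F (NormedSpace.normalize x))
        (SphereApprox.RealizedComplex.ofGeometric K ord)) ∧
    (δ⁻¹ * SphereApprox.ell d δ < 1 / 4 * (Real.log d / (2 * Real.log 2) + 1)⁻¹ →
      SphereApprox.Terminates SphereApprox.RealizedComplex.edgewise L
        (fun x => F (NormedSpace.normalize x))
        (SphereApprox.RealizedComplex.ofGeometric K ord)) := by
  subst hδ
  have hmesh := SphereApprox.sphericalMeshLE_ofGeometric hKvert ord
  have hcard : SphereApprox.FaceCardLE (SphereApprox.RealizedComplex.ofGeometric K ord) (d + 1) :=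
    fun s hs => (SphereApprox.card_le_of_mem_faces_ofGeometric hKrad ord s hs).trans_eq (by simp)
  have h0 := SphereApprox.maxEdgeLength_nonneg K
  have h2 := SphereApprox.maxEdgeLength_le_two hKvert
  constructor
  · intro hell
    exact SphereApprox.terminates_of_mesh _ L hLfin hFcont hFmaps _ fun D hD =>
      SphereApprox.exists_sphericalMeshLE_barycentric hmesh hcard h0 h2 hell hD
  · intro hell
    exact SphereApprox.terminates_of_mesh _ L hLfin hFcont hFmaps _ fun D hD =>
      SphereApprox.exists_sphericalMeshLE_edgewise hd hmesh hcard h0 h2 hell hD
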